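/- Let $n\ge 1$ be an integer and let $\mathbb U=\{z\in\mathbb C:|z|<1\}$. Let $\mathcal A_n$ be the class of functions $f$ analytic in $\mathbb U$ of the form $f(z)=z+a_{n+1}z^{n+1}+a_{n+2}z^{n+2}+\cdots$. For $0<\mu\le 1$ let $\mathcal{STS}(\mu)$ be the class of those $f\in\mathcal A_n$ such that $$\left|\arg\frac{zf'(z)}{f(z)}\right|<\frac{\pi}{2}\mu\qquad(z\in\mathbb U),$$ where the quotient takes its limit value $1$ at $z=0$. Here $\arg$ is the principal argument, and a bound on $\arg w$ includes the assertion that $w$ is defined and $w\neq 0$. Put $$\phi(\mu)=\frac{\pi}{2}(\mu+1)-\arctan\frac{\cos\frac{\mu\pi}{2}}{\sin\frac{\mu\pi}{2}+\frac{n\mu}{1-\mu}\left(\frac{1-\mu}{1+\mu}\right)^{\frac{1+\mu}{2}}}\quad(0<\mu<1),\qquad \phi(1)=\pi .$$ Let $\alpha,\gamma>0$, $\beta\in\mathbb R$ and $0<\mu\le 1$ satisfy $$\alpha=\beta+\frac{2}{\pi}\arctan(n\beta),\qquad \beta=\gamma+\frac{2}{\pi}\arctan(n\gamma),\qquad \frac{\pi}{2}(\alpha+\gamma)\le\phi(\mu).$$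 If $f\in\mathcal A_n$ satisfies $$|\arg f'(z)|<\frac{\pi}{2}\alpha\qquad(z\in\mathbb U),$$ then the Alexander integral $$F(z)=\int_0^z\frac{f(t)}{t}\,dt\qquad(z\in\mathbb U)$$ of $f$ belongs to $\mathcal{STS}(\mu)$. -/

import Mathlib

noncomputable section

/-- The class `𝒜ₙ`: functions analytic in the open unit disk whose expansion at the origin is
`f(z) = z + a_{n+1} z^{n+1} + a_{n+2} z^{n+2} + ⋯`. -/
def classA (n : ℕ) : Set (ℂ → ℂ) :=
  {f | AnalyticOnNhd ℂ f (Metric.ball 0 1) ∧ f 0 = 0 ∧ deriv f 0 = 1 ∧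
    ∀ k : ℕ, 2 ≤ k → k ≤ n → iteratedDeriv k f 0 = 0}

/-- `|arg w| < r` for the principal argument; the argument is defined only for `w ≠ 0`. -/
def AbsArgLT (w : ℂ) (r : ℝ) : Prop :=
  w ≠ 0 ∧ |Complex.arg w| < r

/-- The class `𝒮𝒯𝒮(μ)` of `f ∈ 𝒜ₙ` with `|arg (z f'(z) / f(z))| < (π/2) μ` in the unit disk.
At `z = 0` the quotient has the removable value `1`, whose argument is `0`, so only `z ≠ 0`
has to be tested. -/
def classSTS (n : ℕ) (μ : ℝ) : Set (ℂ → ℂ) :=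
  {f | f ∈ classA n ∧ ∀ z ∈ Metric.ball (0 : ℂ) 1, z ≠ 0 →
    f z ≠ 0 ∧ AbsArgLT (z * deriv f z / f z) (Real.pi / 2 * μ)}

/-- The Alexander integral `F(z) = ∫₀ᶻ f(t)/t dt`, along the segment `t = s z`, `0 ≤ s ≤ 1`. -/
def alexander (f : ℂ → ℂ) (z : ℂ) : ℂ :=
  ∫ s in (0 : ℝ)..1, f ((s : ℂ) * z) / ((s : ℂ) * z) * z

/-- The bound `φ(μ)`, for `0 < μ ≤ 1`. At `μ = 1` it is `π`, see `phiBound_one`. -/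
def phiBound (n : ℕ) (μ : ℝ) : ℝ :=
  Real.pi / 2 * (μ + 1) -
    Real.arctan (Real.cos (μ * Real.pi / 2) /
      (Real.sin (μ * Real.pi / 2) +
        (n : ℝ) * μ / (1 - μ) * ((1 - μ) / (1 + μ)) ^ ((1 + μ) / 2)))

/-- The value at `μ = 1` is the limit of the formula as `μ → 1`, because the cosine vanishes
and the denominator tends to `1 + n / 2`. -/
theorem phiBound_one (n : ℕ) : phiBound n 1 = Real.pi := by
  simp [phiBound]
  ring

end

/-! Put p = f/z, q = F/z and P = p/q = zF'/F. Since F' = p, one has p + zp' = f', q + zq' = p and P²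
+ zP' = f'/q. Sector bounds are therefore passed on three times: from f' (half-angle πα/2) to p
(πβ/2), from p to q (πγ/2), and from f'/q, whose argument is below π(α+γ)/2 ≤ φ(μ), to P (πμ/2).

Each passage rests on Nunokawa's lemma `exists_exit_point`. Write the function as exp L with L
vanishing to order n at 0. Where |Im L| first reaches πβ/2, the Cayley transform of exp(L/β) attains
its maximal modulus 1, and Jack's lemma gives zL' = ±ikβ with k ≥ n(a + 1/a)/2 ≥ n. For p and q, the
factor 1 + zL' then adds at least arctan(nβ) to the argument, which is the relation between α and β.
For P, minimising (a + 1/a)/a^μ over a produces φ(μ).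

Two points need care. A logarithm requires p and q to be zero-free; `ne_zero_of_log_on_ball`
excludes a first zero by a tangent-cone argument. And a lifted argument may exceed π, so cosines are
compared instead of arguments. -/

open Complex Metric Filter Topology

/-! ### Boundary maxima: the lemmas of Jack and Nunokawa -/

/-- If `‖h‖` on the closed disk of radius `‖z₀‖` is maximal at `z₀ ≠ 0`, then
`z₀ h'(z₀) = c h(z₀)` with a real `c ≥ 0`. -/
theorem exists_nonneg_mul_deriv_eq_of_norm_le {h : ℂ → ℂ} {z₀ : ℂ}
    (hd : DifferentiableAt ℂ h z₀) (h0 : h z₀ ≠ 0)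
    (hmax : ∀ z, ‖z‖ ≤ ‖z₀‖ → ‖h z‖ ≤ ‖h z₀‖) :
    ∃ c : ℝ, 0 ≤ c ∧ z₀ * deriv h z₀ = c * h z₀ := by
  set A : ℂ := z₀ * deriv h z₀ / h z₀ with hA
  -- For Re ζ < 0 the point 1 + tζ lies in the unit disk for small t > 0, so the real part of
  -- h/h(z₀) cannot exceed 1 in that direction. Multiplication by A thus preserves the left
  -- half-plane, which forces A to be real and nonnegative.
  have key : ∀ ζ : ℂ, ζ.re < 0 → (A * ζ).re ≤ 0 := by
    intro ζ hζ
    have hder : HasDerivAt (fun t : ℝ => h (z₀ * (1 + t * ζ)) / h z₀) (A * ζ) 0 := by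
      have h1 : HasDerivAt (fun t : ℂ => z₀ * (1 + t * ζ)) (z₀ * ζ) ((0 : ℝ) : ℂ) := by
        simpa using (((hasDerivAt_id ((0 : ℝ) : ℂ)).mul_const ζ).const_add 1).const_mul z₀
      have h2 : HasDerivAt h (deriv h z₀) (z₀ * (1 + ((0 : ℝ) : ℂ) * ζ)) := by
        simpa using hd.hasDerivAt
      have h3 := ((h2.comp ((0 : ℝ) : ℂ) h1).div_const (h z₀)).comp_ofReal
      exact h3.congr_deriv (by rw [hA]; ring)
    have hre : HasDerivAt (fun t : ℝ => (h (z₀ * (1 + t * ζ)) / h z₀).re) (A * ζ).re 0 := by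
      exact Complex.reCLM.hasFDerivAt.comp_hasDerivAt (0 : ℝ) hder
    have hsl := hre.tendsto_slope.mono_left (nhdsWithin_mono (0 : ℝ) (s := Set.Ioi 0)
      (fun x hx => ne_of_gt hx))
    refine le_of_tendsto hsl ?_
    have hz : ζ ≠ 0 := by rintro rfl; simp at hζ
    have hpos : 0 < -2 * ζ.re / ‖ζ‖ ^ 2 := by
      apply div_pos (by linarith); positivity
    filter_upwards [Ioo_mem_nhdsGT hpos] with t ht
    have ht0 := ht.1
    have ht1 : t * ‖ζ‖ ^ 2 < -2 * ζ.re := (lt_div_iff₀ (by positivity)).1 ht.2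
    have hn : ‖1 + (t : ℂ) * ζ‖ ≤ 1 := by
      rw [← sq_le_sq₀ (norm_nonneg _) zero_le_one, ← Complex.normSq_eq_norm_sq]
      rw [← Complex.normSq_eq_norm_sq] at ht1
      simp only [Complex.normSq_apply] at *
      simp
      nlinarith
    have hle : ‖h (z₀ * (1 + t * ζ)) / h z₀‖ ≤ 1 := by
      rw [norm_div]
      apply div_le_one_of_le₀ _ (norm_nonneg _)
      apply hmax
      rw [norm_mul]
      exact mul_le_of_le_one_right (norm_nonneg _) hn
    have := (Complex.re_le_norm _).trans hle
    simp only [slope_def_field, Complex.ofReal_zero, zero_mul, add_zero, mul_one, div_self h0,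
      Complex.one_re, sub_zero]
    exact div_nonpos_of_nonpos_of_nonneg (by linarith) ht0.le
  have key' : ∀ ζ : ℂ, ζ.re ≤ 0 → (A * ζ).re ≤ 0 := by
    intro ζ hζ
    have hc : Tendsto (fun t : ℝ => (A * (ζ - t)).re) (𝓝[>] 0) (𝓝 (A * (ζ - (0 : ℝ))).re) := by
      apply Tendsto.mono_left _ nhdsWithin_le_nhds
      exact Continuous.tendsto (by fun_prop) 0
    rw [Complex.ofReal_zero, sub_zero] at hc
    refine le_of_tendsto hc ?_
    filter_upwards [self_mem_nhdsWithin] with t ht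
    apply key
    have : (0 : ℝ) < t := ht
    simp; linarith
  have h1 := key' Complex.I (by simp)
  have h2 := key' (-Complex.I) (by simp)
  have h3 := key' (-1) (by simp)
  simp at h1 h2 h3
  refine ⟨A.re, h3, ?_⟩
  have : A = (A.re : ℂ) := by apply Complex.ext <;> simp; linarith
  rw [← this, hA]; field_simp

/-- **Jack's lemma** for `w(z) = zⁿ h(z)`. -/
theorem jack_lemma {h : ℂ → ℂ} {n : ℕ} {z₀ : ℂ} {U : Set ℂ} (hU : IsOpen U)
    (hsub : closedBall 0 ‖z₀‖ ⊆ U) (hz₀ : z₀ ≠ 0) (hd : DifferentiableOn ℂ h U)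
    (hle : ∀ z, ‖z‖ ≤ ‖z₀‖ → ‖z ^ n * h z‖ ≤ 1) (heq : ‖z₀ ^ n * h z₀‖ = 1) :
    ∃ m : ℝ, n ≤ m ∧ z₀ * deriv (fun z => z ^ n * h z) z₀ = m * (z₀ ^ n * h z₀) := by
  have hr : 0 < ‖z₀‖ := norm_pos_iff.2 hz₀
  have h0 : h z₀ ≠ 0 := by
    intro h; simp [h] at heq
  have hdz : DifferentiableAt ℂ h z₀ := hd.differentiableAt (hU.mem_nhds (hsub (by simp)))
  -- On the circle through z₀ the factor zⁿ has constant modulus, so the bound passes to h there,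
  -- and inside by the maximum principle.
  have hmax : ∀ z, ‖z‖ ≤ ‖z₀‖ → ‖h z‖ ≤ ‖h z₀‖ := by
    intro z hz
    refine Complex.norm_le_of_forall_mem_frontier_norm_le (U := ball (0 : ℂ) ‖z₀‖)
      Metric.isBounded_ball ?_ ?_ ?_
    · refine ⟨hd.mono (ball_subset_closedBall.trans hsub), ?_⟩
      exact hd.continuousOn.mono (closure_ball_subset_closedBall.trans hsub)
    · intro y hy
      rw [frontier_ball _ hr.ne', mem_sphere_zero_iff_norm] at hy
      have := hle y hy.le
      rw [norm_mul, norm_pow] at this heq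
      rw [hy] at this
      have hp : 0 < ‖z₀‖ ^ n := by positivity
      rw [← heq] at this
      exact le_of_mul_le_mul_left this hp
    · rw [closure_ball _ hr.ne']; simpa using hz
  obtain ⟨c, hc, hcd⟩ := exists_nonneg_mul_deriv_eq_of_norm_le hdz h0 hmax
  refine ⟨n + c, by linarith, ?_⟩
  rw [deriv_fun_mul (by fun_prop) hdz]
  simp only [deriv_pow_field]
  have : z₀ * (n * z₀ ^ (n - 1)) = n * z₀ ^ n := by
    rcases n with _ | n
    · simp
    · simp [pow_succ]; ring
  push_cast
  linear_combination h z₀ * this + z₀ ^ n * hcd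

/-- A holomorphic function on a disk vanishing to order at least `n` at the centre is divisible
by `zⁿ`. -/
theorem exists_eq_pow_mul {L : ℂ → ℂ} {R : ℝ} {n : ℕ} (hR : 0 < R)
    (hL : DifferentiableOn ℂ L (ball 0 R)) (hn : n ≤ analyticOrderAt L 0) :
    ∃ l : ℂ → ℂ, DifferentiableOn ℂ l (ball 0 R) ∧ ∀ z ∈ ball (0 : ℂ) R, L z = z ^ n * l z := by
  have han : AnalyticAt ℂ L 0 := hL.analyticAt (ball_mem_nhds _ hR)
  obtain ⟨g, hg, hgL⟩ := (natCast_le_analyticOrderAt han).1 hn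
  simp only [sub_zero, smul_eq_mul] at hgL
  refine ⟨fun z => if z = 0 then g 0 else L z / z ^ n, ?_, ?_⟩
  · intro z hz
    by_cases h0 : z = 0
    · subst h0
      refine (hg.differentiableAt.congr_of_eventuallyEq ?_).differentiableWithinAt
      filter_upwards [hgL] with z hz
      split_ifs with h
      · rw [h]
      · rw [hz]; field_simp
    · have h1 : DifferentiableAt ℂ (fun z => L z / z ^ n) z :=
        (hL.differentiableAt (isOpen_ball.mem_nhds hz)).div (by fun_prop) (pow_ne_zero _ h0)
      refine (h1.congr_of_eventuallyEq ?_).differentiableWithinAt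
      filter_upwards [isOpen_ne.mem_nhds h0] with y hy
      simp only [ite_eq_right_iff]
      exact fun h => absurd h hy
  · intro z hz
    by_cases h0 : z = 0
    · subst h0; simpa using hgL.self_of_nhds
    · simp [h0]; field_simp

/-- **Nunokawa's lemma**, in logarithmic form: if `exp ∘ L` does not stay inside the sector of
half-angle `πβ/2`, then at a first exit point `z₀` the logarithmic derivative is
`± i k β` with `k ≥ n (a + a⁻¹) / 2`. -/
theorem exists_exit_point {L : ℂ → ℂ} {R β : ℝ} {n : ℕ} (hn : 1 ≤ n) (hβ : 0 < β)
    (hL : DifferentiableOn ℂ L (ball 0 R)) (hord : n ≤ analyticOrderAt L 0)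
    (hex : ∃ z ∈ ball (0 : ℂ) R, Real.pi / 2 * β ≤ |(L z).im|) :
    ∃ z₀ ∈ ball (0 : ℂ) R, ∃ s k : ℝ, (s = 1 ∨ s = -1) ∧
      n / 2 * (Real.exp ((L z₀).re / β) + (Real.exp ((L z₀).re / β))⁻¹) ≤ k ∧
      (L z₀).im = s * (Real.pi / 2 * β) ∧ z₀ * deriv L z₀ = s * k * β * I := by
  obtain ⟨zs, hzs, hzc⟩ := hex
  have hR : 0 < R := pos_of_mem_ball hzs
  have hc : 0 < Real.pi / 2 * β := by positivity
  have hcont : ContinuousOn (fun z => |(L z).im|) (ball 0 R) :=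
    (continuous_abs.comp Complex.continuous_im).comp_continuousOn hL.continuousOn
  have hsub1 : closedBall (0 : ℂ) ‖zs‖ ⊆ ball 0 R := by
    apply closedBall_subset_ball; simpa using hzs
  have hK : IsCompact
      (closedBall (0 : ℂ) ‖zs‖ ∩ (fun z => |(L z).im|) ⁻¹' Set.Ici (Real.pi / 2 * β)) := by
    apply (isCompact_closedBall _ _).of_isClosed_subset _ Set.inter_subset_left
    exact (hcont.mono hsub1).preimage_isClosed_of_isClosed isClosed_closedBall isClosed_Ici
  obtain ⟨z₀, ⟨hz₀b, hz₀c⟩, hmin⟩ :=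
    hK.exists_isMinOn ⟨zs, by simp, hzc⟩ continuous_norm.continuousOn
  have hz₀R := hsub1 hz₀b
  have hL0 : L 0 = 0 := by
    apply apply_eq_zero_of_analyticOrderAt_ne_zero
    intro h
    rw [h] at hord
    have : n = 0 := by simpa using hord
    omega
  have hz₀ : z₀ ≠ 0 := by
    rintro rfl
    simp [hL0] at hz₀c
    linarith
  have hr : 0 < ‖z₀‖ := norm_pos_iff.2 hz₀
  have hin : ∀ z ∈ ball (0 : ℂ) ‖z₀‖, |(L z).im| ≤ Real.pi / 2 * β := by
    intro z hz
    by_contra! hcon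
    have h1 : ‖z‖ < ‖z₀‖ := by simpa using hz
    have h2 : ‖z₀‖ ≤ ‖zs‖ := by simpa using hz₀b
    have := hmin (a := z) ⟨by simpa using (h1.le.trans h2), hcon.le⟩
    simp at this
    linarith
  have hsub2 : closedBall (0 : ℂ) ‖z₀‖ ⊆ ball 0 R := by
    apply closedBall_subset_ball; simpa using hz₀R
  have hcl : ∀ z ∈ closedBall (0 : ℂ) ‖z₀‖, |(L z).im| ≤ Real.pi / 2 * β := by
    rw [← closure_ball _ hr.ne'] at hsub2 ⊢
    intro z hz
    exact le_on_closure (f := fun z => |(L z).im|) (g := fun _ => Real.pi / 2 * β) hin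
      (hcont.mono hsub2) continuousOn_const hz
  have heq : |(L z₀).im| = Real.pi / 2 * β := le_antisymm (hcl z₀ (by simp)) hz₀c
  obtain ⟨s, hs, hsim⟩ : ∃ s : ℝ, (s = 1 ∨ s = -1) ∧ (L z₀).im = s * (Real.pi / 2 * β) := by
    rcases abs_eq hc.le |>.1 heq with h | h
    · exact ⟨1, Or.inl rfl, by linarith⟩
    · exact ⟨-1, Or.inr rfl, by linarith⟩
  set a := Real.exp ((L z₀).re / β) with ha
  have ha0 : 0 < a := Real.exp_pos _
  obtain ⟨l, hl, hLl⟩ := exists_eq_pow_mul hR hL hord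
  -- The power 1/β opens the sector to the right half-plane, which w = (q - 1)/(q + 1) carries to
  -- the unit disk.
  set q : ℂ → ℂ := fun z => Complex.exp (L z / β) with hq
  have hqre : ∀ z ∈ closedBall (0 : ℂ) ‖z₀‖, 0 ≤ (q z).re := by
    intro z hz
    have := abs_le.1 (hcl z hz)
    simp only [hq, Complex.exp_re]
    apply mul_nonneg (Real.exp_pos _).le
    rw [Complex.div_ofReal_im]
    apply Real.cos_nonneg_of_neg_pi_div_two_le_of_le
    · rw [le_div_iff₀ hβ]; linarith
    · rw [div_le_iff₀ hβ]; linarith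
  have hqz : q z₀ = s * a * I := by
    have hβ' : (β : ℂ) ≠ 0 := by exact_mod_cast hβ.ne'
    have h1 : L z₀ / β = ((L z₀).re / β : ℝ) + (s * (Real.pi / 2) : ℝ) * I := by
      conv_lhs => rw [← Complex.re_add_im (L z₀), hsim]
      push_cast; field_simp
    simp only [hq]
    rw [h1, Complex.exp_add, ← Complex.ofReal_exp, ← ha]
    rcases hs with rfl | rfl
    · simp [Complex.exp_pi_div_two_mul_I]
    · have : ((-1 * (Real.pi / 2) : ℝ) : ℂ) * I = -Real.pi / 2 * I := by push_cast; ring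
      rw [this, Complex.exp_neg_pi_div_two_mul_I]; simp
  set U : Set ℂ := ball 0 R ∩ {z | q z + 1 ≠ 0} with hUdef
  have hqd : DifferentiableOn ℂ q (ball 0 R) := (hL.div_const _).cexp
  have hU : IsOpen U :=
    (hqd.continuousOn.add continuousOn_const).isOpen_inter_preimage isOpen_ball isOpen_ne
  have hq1 : ∀ z ∈ closedBall (0 : ℂ) ‖z₀‖, q z + 1 ≠ 0 := by
    intro z hz h
    have := congrArg Complex.re h
    simp at this
    linarith [hqre z hz]
  have hUsub : closedBall (0 : ℂ) ‖z₀‖ ⊆ U := fun z hz => ⟨hsub2 hz, hq1 z hz⟩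
  -- The entire function (exp u - 1)/u lets the factor zⁿ of L be taken out of q - 1, so that w =
  -- zⁿh with h holomorphic.
  set E : ℂ → ℂ := dslope Complex.exp 0 with hE
  have hEd : Differentiable ℂ E := by
    rw [← differentiableOn_univ]
    exact (Complex.differentiableOn_dslope univ_mem).2 Complex.differentiable_exp.differentiableOn
  have hEu : ∀ u, Complex.exp u - 1 = u * E u := by
    intro u
    have := sub_smul_dslope Complex.exp 0 u
    simp at this
    exact this.symm
  set h : ℂ → ℂ := fun z => l z / β * E (L z / β) / (q z + 1) with hh
  have hhd : DifferentiableOn ℂ h U := by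
    have hl' := hl.mono (Set.inter_subset_left : U ⊆ _)
    have hL' := hL.mono (Set.inter_subset_left : U ⊆ _)
    have hq' := hqd.mono (Set.inter_subset_left : U ⊆ _)
    refine DifferentiableOn.div ?_ (hq'.add_const _) (fun z hz => hz.2)
    exact (hl'.div_const _).mul (hEd.comp_differentiableOn (hL'.div_const _))
  have hw : ∀ z ∈ ball (0 : ℂ) R, z ^ n * h z = (q z - 1) / (q z + 1) := by
    intro z hz
    simp only [hh]
    have : q z - 1 = L z / β * E (L z / β) := hEu _
    rw [this, hLl z hz]; ring
  obtain ⟨m, hm, hjack⟩ := jack_lemma (n := n) hU hUsub hz₀ hhd (by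
    intro z hz
    have hz' : z ∈ closedBall (0 : ℂ) ‖z₀‖ := by simpa using hz
    rw [hw z (hsub2 hz'), norm_div]
    apply div_le_one_of_le₀ _ (norm_nonneg _)
    rw [← sq_le_sq₀ (norm_nonneg _) (norm_nonneg _), ← Complex.normSq_eq_norm_sq,
      ← Complex.normSq_eq_norm_sq]
    simp only [Complex.normSq_apply]
    simp
    nlinarith [hqre z hz']) (by
    rw [hw z₀ hz₀R, norm_div, div_eq_one_iff_eq (norm_ne_zero_iff.2 (hq1 z₀ (by simp))),
      ← sq_eq_sq₀ (norm_nonneg _) (norm_nonneg _), ← Complex.normSq_eq_norm_sq,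
      ← Complex.normSq_eq_norm_sq, hqz]
    simp only [Complex.normSq_apply]
    simp)
  -- Jack's lemma reads 2zq'/(q² - 1) = m. With q = sai this becomes zL' = βm(q - 1/q)/2 = siβ · m(a
  -- + 1/a)/2.
  refine ⟨z₀, hz₀R, s, m / 2 * (a + a⁻¹), hs, ?_, hsim, ?_⟩
  · have : 0 < a⁻¹ := by positivity
    gcongr
  · have hev : (fun z => z ^ n * h z) =ᶠ[𝓝 z₀] fun z => (q z - 1) / (q z + 1) := by
      filter_upwards [isOpen_ball.mem_nhds hz₀R] with z hz using hw z hz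
    rw [hev.deriv_eq, hw z₀ hz₀R] at hjack
    have hLd : HasDerivAt L (deriv L z₀) z₀ :=
      (hL.differentiableAt (isOpen_ball.mem_nhds hz₀R)).hasDerivAt
    have hqD : HasDerivAt q (q z₀ * (deriv L z₀ / β)) z₀ := (hLd.div_const _).cexp
    have hne := hq1 z₀ (by simp)
    rw [((hqD.sub_const 1).fun_div (hqD.add_const 1) hne).deriv] at hjack
    have hβ' : (β : ℂ) ≠ 0 := by exact_mod_cast hβ.ne'
    have ha' : (a : ℂ) ≠ 0 := by exact_mod_cast ha0.ne'
    have hs2 : (s : ℂ) ^ 2 = 1 := by rcases hs with rfl | rfl <;> simp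
    have hs0 : (s : ℂ) ≠ 0 := by rintro h; simp [h] at hs2
    field_simp at hjack
    have hj2 : z₀ * deriv L z₀ * (2 * q z₀) = m * β * (q z₀ ^ 2 - 1) := by
      linear_combination hjack
    rw [hqz] at hj2
    have hne2 : (2 * (s * a * I) : ℂ) ≠ 0 := by simp [hs0, ha']
    apply mul_right_cancel₀ hne2
    rw [hj2]
    push_cast
    field_simp
    linear_combination -(m * (s : ℂ) ^ 2) * I_sq + m * hs2

/-! ### Holomorphic logarithms -/

/-- A zero-free holomorphic function on a disk has a holomorphic logarithm. -/
theorem exists_log_on_ball {p : ℂ → ℂ} {R : ℝ} (hR : 0 < R)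
    (hp : DifferentiableOn ℂ p (ball 0 R)) (hp0 : p 0 = 1) (hne : ∀ z ∈ ball (0 : ℂ) R, p z ≠ 0) :
    ∃ L : ℂ → ℂ, DifferentiableOn ℂ L (ball 0 R) ∧ L 0 = 0 ∧
      ∀ z ∈ ball (0 : ℂ) R, Complex.exp (L z) = p z := by
  have hq : DifferentiableOn ℂ (fun z => deriv p z / p z) (ball 0 R) :=
    (hp.deriv isOpen_ball).div hp hne
  obtain ⟨L, hL0, hL⟩ := hq.isExactOn_ball.with_val_at 0 0
  have hLd : DifferentiableOn ℂ L (ball 0 R) :=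
    fun z hz => (hL z hz).differentiableAt.differentiableWithinAt
  refine ⟨L, hLd, hL0, ?_⟩
  have hder : ∀ z ∈ ball (0 : ℂ) R, HasDerivAt (fun z => p z * Complex.exp (-L z)) 0 z := by
    intro z hz
    have h1 := (hp.differentiableAt (isOpen_ball.mem_nhds hz)).hasDerivAt
    refine (h1.mul (hL z hz).neg.cexp).congr_deriv ?_
    have := hne z hz
    simp only [Pi.neg_apply]
    field_simp
    ring
  have hconst : ∀ z ∈ ball (0 : ℂ) R, p z * Complex.exp (-L z) = p 0 * Complex.exp (-L 0) := by
    intro z hz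
    exact isOpen_ball.is_const_of_deriv_eq_zero (convex_ball _ _).isPreconnected
      (fun z hz => (hder z hz).differentiableAt.differentiableWithinAt)
      (fun z hz => (hder z hz).deriv) hz (mem_ball_self hR)
  intro z hz
  have := hconst z hz
  rw [hp0, hL0, neg_zero, Complex.exp_zero, Complex.exp_neg, mul_one] at this
  have hE := Complex.exp_ne_zero (L z)
  field_simp at this
  exact this.symm

/-- The order of vanishing of `L` and of `exp L - 1` agree at a zero of `L`. -/
theorem analyticOrderAt_log {p L : ℂ → ℂ} (hL : AnalyticAt ℂ L 0) (hL0 : L 0 = 0)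
    (h : ∀ᶠ z in 𝓝 0, Complex.exp (L z) = p z) :
    analyticOrderAt L 0 = analyticOrderAt (fun z => p z - 1) 0 := by
  have h1 : (fun z => p z - 1) =ᶠ[𝓝 0] (fun u => Complex.exp u - 1) ∘ L := by
    filter_upwards [h] with z hz
    simp [hz]
  have h2 : analyticOrderAt (fun u => Complex.exp u - 1) (L 0) = 1 := by
    have := AnalyticAt.analyticOrderAt_sub_eq_one_of_deriv_ne_zero
      (f := Complex.exp) (x := 0) (by fun_prop) (by simp)
    rw [hL0]
    simpa using this
  rw [analyticOrderAt_congr h1, AnalyticAt.analyticOrderAt_comp (by fun_prop) hL, h2]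
  simp [hL0]

/-! ### Principal and lifted arguments -/

/-- The cosine does not see multiples of 2π, so it compares a lifted argument with the principal one
without choosing a branch. -/
theorem AbsArgLT.cos_lt_cos_im {u : ℂ} {A : ℝ} (hA : A ≤ Real.pi)
    (h : AbsArgLT (Complex.exp u) A) : Real.cos A < Real.cos u.im := by
  have h1 : Real.cos (Complex.arg (Complex.exp u)) = Real.cos u.im := by
    rw [Complex.cos_arg h.1, Complex.exp_re, Complex.norm_exp]
    field_simp
  rw [← h1, ← Real.cos_abs (Complex.arg _)]
  exact Real.cos_lt_cos_of_nonneg_of_le_pi (abs_nonneg _) hA h.2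

theorem absArgLT_exp {u : ℂ} {A : ℝ} (hA : A ≤ Real.pi) (h : |u.im| < A) :
    AbsArgLT (Complex.exp u) A := by
  refine ⟨Complex.exp_ne_zero _, ?_⟩
  have h' := abs_lt.1 h
  rwa [← Complex.log_im, Complex.log_exp (by linarith) (by linarith)]

theorem cos_le_cos_of_le_abs {A y : ℝ} (hA0 : 0 ≤ A) (h1 : A ≤ |y|) (h2 : |y| ≤ 2 * Real.pi - A) :
    Real.cos y ≤ Real.cos A := by
  rw [← Real.cos_abs y]
  rcases le_total |y| Real.pi with h | h
  · exact Real.cos_le_cos_of_nonneg_of_le_pi hA0 h h1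
  · rw [← Real.cos_two_pi_sub |y|]
    exact Real.cos_le_cos_of_nonneg_of_le_pi hA0 (by linarith) (by linarith)

theorem exists_exp_eq_of_re_pos {x : ℝ} (y : ℝ) (hx : 0 < x) :
    ∃ ρ : ℝ, Complex.exp (ρ + Real.arctan (y / x) * I) = x + y * I := by
  refine ⟨Real.log (x * √(1 + (y / x) ^ 2)), ?_⟩
  have hpos : 0 < √(1 + (y / x) ^ 2) := by positivity
  rw [Complex.exp_add, ← Complex.ofReal_exp, Real.exp_log (by positivity), Complex.exp_mul_I,
    ← Complex.ofReal_cos, ← Complex.ofReal_sin, Real.cos_arctan, Real.sin_arctan]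
  have h1 : (x * √(1 + (y / x) ^ 2)) * (1 / √(1 + (y / x) ^ 2)) = x := by field_simp
  have h2 : (x * √(1 + (y / x) ^ 2)) * (y / x / √(1 + (y / x) ^ 2)) = y := by
    generalize √(1 + (y / x) ^ 2) = c at *
    field_simp
  rw [mul_add, ← mul_assoc, ← Complex.ofReal_mul, ← Complex.ofReal_mul, h1, h2]

/-- Multiplication by -si turns x + siy into y - six, which has positive real part; the quarter turn
is then undone. -/
theorem exists_exp_eq_of_im_pos (x : ℝ) {y s : ℝ} (hy : 0 < y) (hs : s = 1 ∨ s = -1) :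
    ∃ ρ : ℝ, Complex.exp (ρ + (s * (Real.pi / 2 - Real.arctan (x / y)) : ℝ) * I) = x + s * y * I := by
  obtain ⟨ρ, hρ⟩ := exists_exp_eq_of_re_pos (-s * x) hy
  refine ⟨ρ, ?_⟩
  rcases hs with rfl | rfl
  · have : (ρ + (1 * (Real.pi / 2 - Real.arctan (x / y)) : ℝ) * I : ℂ)
        = (ρ + Real.arctan (-1 * x / y) * I) + Real.pi / 2 * I := by
      rw [neg_one_mul, neg_div, Real.arctan_neg]; push_cast; ring
    rw [this, Complex.exp_add, hρ, Complex.exp_pi_div_two_mul_I]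
    push_cast
    linear_combination -x * I_sq
  · have : (ρ + (-1 * (Real.pi / 2 - Real.arctan (x / y)) : ℝ) * I : ℂ)
        = (ρ + Real.arctan (- -1 * x / y) * I) + -Real.pi / 2 * I := by
      rw [neg_neg, one_mul]; push_cast; ring
    rw [this, Complex.exp_add, hρ, Complex.exp_neg_pi_div_two_mul_I]
    push_cast
    linear_combination -x * I_sq

/-! ### From p + zp' to p -/

/-- If `exp L · (1 + z L')` stays in the sector of half-angle `πα/2`, where
`α = β + (2/π) arctan (nβ)`, then `exp L` stays in that of half-angle `πβ/2`. -/
theorem abs_im_lt_of_absArgLT {L : ℂ → ℂ} {R α β : ℝ} {n : ℕ} (hn : 1 ≤ n) (hβ : 0 < β)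
    (hαβ : α = β + 2 / Real.pi * Real.arctan (n * β)) (hα2 : α ≤ 2) (hsum : α + β < 3)
    (hL : DifferentiableOn ℂ L (ball 0 R)) (hord : n ≤ analyticOrderAt L 0)
    (harg : ∀ z ∈ ball (0 : ℂ) R,
      AbsArgLT (Complex.exp (L z) * (1 + z * deriv L z)) (Real.pi / 2 * α)) :
    ∀ z ∈ ball (0 : ℂ) R, |(L z).im| < Real.pi / 2 * β := by
  by_contra! hcon
  obtain ⟨z₀, hz₀, s, k, hs, hk, him, hder⟩ := exists_exit_point hn hβ hL hord hcon
  have hpi := Real.pi_pos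
  have hn' : (1 : ℝ) ≤ n := by exact_mod_cast hn
  set a := Real.exp ((L z₀).re / β)
  have ha : 0 < a := Real.exp_pos _
  have hnk : n ≤ k := by
    have : 2 ≤ a + a⁻¹ := by
      have h : a * a⁻¹ = 1 := mul_inv_cancel₀ ha.ne'
      nlinarith [sq_nonneg (a - a⁻¹), inv_pos.2 ha]
    nlinarith
  have hat : Real.arctan (n * β) ≤ Real.arctan (k * β) :=
    Real.arctan_strictMono.monotone (by gcongr)
  have hat0 : 0 < Real.arctan (n * β) := Real.arctan_pos.2 (by positivity)
  have hα : Real.pi / 2 * α = Real.pi / 2 * β + Real.arctan (n * β) := by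
    rw [hαβ]; field_simp
  obtain ⟨ρ, hρ⟩ := exists_exp_eq_of_re_pos (s * (k * β)) one_pos
  have h := harg z₀ hz₀
  have heq : Complex.exp (L z₀) * (1 + z₀ * deriv L z₀)
      = Complex.exp (L z₀ + (ρ + Real.arctan (s * (k * β) / 1) * I)) := by
    rw [Complex.exp_add, hρ, hder]; push_cast; ring
  rw [heq] at h
  have hcos := h.cos_lt_cos_im (by nlinarith)
  have him2 : |(L z₀ + (ρ + Real.arctan (s * (k * β) / 1) * I)).im|
      = Real.pi / 2 * β + Real.arctan (k * β) := by
    have hval : (L z₀ + (ρ + Real.arctan (s * (k * β) / 1) * I)).im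
        = s * (Real.pi / 2 * β + Real.arctan (k * β)) := by
      simp only [div_one, Complex.add_im, him, Complex.ofReal_im, Complex.mul_I_im,
        Complex.ofReal_re, zero_add]
      rcases hs with rfl | rfl
      · simp
      · rw [neg_one_mul, neg_one_mul, Real.arctan_neg]; ring
    have hpos : 0 ≤ Real.pi / 2 * β + Real.arctan (k * β) := by
      have : 0 < Real.pi / 2 * β := by positivity
      linarith
    rw [hval, abs_mul, abs_of_nonneg hpos]
    rcases hs with rfl | rfl <;> simp
  -- The lifted argument is below π(β + 1)/2 < 2π - πα/2, because α + β < 3. Hence it cannot wrap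
  -- round and re-enter the sector.
  have hle := cos_le_cos_of_le_abs (A := Real.pi / 2 * α)
    (y := (L z₀ + (ρ + Real.arctan (s * (k * β) / 1) * I)).im) (by rw [hα]; positivity)
    (by rw [him2, hα]; linarith)
    (by
      rw [him2]
      have := Real.arctan_lt_pi_div_two (k * β)
      nlinarith)
  linarith

/-- Suppose `p` maps the disk of radius `‖z₁‖` into the sector of half-angle `πβ/2`. If
`p + z p'` has argument less than `πα/2` in modulus at `z₁`, where `α + β < 3`, then `p` does not
vanish at `z₁`. -/
theorem ne_zero_of_log_on_ball {p L : ℂ → ℂ} {α β : ℝ} {z₁ : ℂ} (hz₁ : z₁ ≠ 0)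
    (hβ : 0 < β) (hβ2 : β < 2) (hsum : α + β < 3)
    (hp : DifferentiableAt ℂ p z₁)
    (hL : ∀ z ∈ ball (0 : ℂ) ‖z₁‖, Complex.exp (L z) = p z)
    (him : ∀ z ∈ ball (0 : ℂ) ‖z₁‖, |(L z).im| < Real.pi / 2 * β)
    (harg : AbsArgLT (p z₁ + z₁ * deriv p z₁) (Real.pi / 2 * α)) : p z₁ ≠ 0 := by
  intro hp1
  have hpi := Real.pi_pos
  rw [hp1, zero_add] at harg
  set g := z₁ * deriv p z₁ with hg
  set c := Real.cos (Real.pi / 2 * β) with hc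
  -- The sector as a closed cone: the inequality is positively homogeneous and survives limits, so
  -- it passes to derivatives at the zero z₁.
  have hcone : ∀ z ∈ ball (0 : ℂ) ‖z₁‖, ‖p z‖ * c ≤ (p z).re := by
    intro z hz
    rw [← hL z hz, Complex.norm_exp, Complex.exp_re, ← Real.cos_abs (L z).im]
    apply mul_le_mul_of_nonneg_left _ (Real.exp_pos _).le
    exact Real.cos_le_cos_of_nonneg_of_le_pi (abs_nonneg _) (by nlinarith) (him z hz).le
  have key : ∀ ζ : ℂ, 0 < ζ.re → ‖-ζ * g‖ * c ≤ (-ζ * g).re := by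
    intro ζ hζ
    have hder : HasDerivAt (fun t : ℝ => p (z₁ * (1 - t * ζ))) (-ζ * g) 0 := by
      have h1 : HasDerivAt (fun t : ℂ => z₁ * (1 - t * ζ)) (z₁ * -ζ) ((0 : ℝ) : ℂ) := by
        simpa using (((hasDerivAt_id ((0 : ℝ) : ℂ)).mul_const ζ).const_sub 1).const_mul z₁
      have h2 : HasDerivAt p (deriv p z₁) (z₁ * (1 - ((0 : ℝ) : ℂ) * ζ)) := by
        simpa using hp.hasDerivAt
      exact ((h2.comp ((0 : ℝ) : ℂ) h1).comp_ofReal).congr_deriv (by rw [hg]; ring)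
    have hsl := hder.tendsto_slope.mono_left (nhdsWithin_mono (0 : ℝ) (s := Set.Ioi 0)
      (fun x hx => ne_of_gt hx))
    have hz : ζ ≠ 0 := by rintro rfl; simp at hζ
    have hpos : 0 < 2 * ζ.re / ‖ζ‖ ^ 2 := by
      apply div_pos (by linarith); positivity
    refine le_of_tendsto_of_tendsto (hsl.norm.mul_const c)
      ((Complex.continuous_re.tendsto _).comp hsl) ?_
    filter_upwards [Ioo_mem_nhdsGT hpos] with t ht
    have ht0 := ht.1
    have ht1 : t * ‖ζ‖ ^ 2 < 2 * ζ.re := (lt_div_iff₀ (by positivity)).1 ht.2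
    have hn : ‖1 - (t : ℂ) * ζ‖ < 1 := by
      rw [← sq_lt_sq₀ (norm_nonneg _) zero_le_one, ← Complex.normSq_eq_norm_sq]
      rw [← Complex.normSq_eq_norm_sq] at ht1
      simp only [Complex.normSq_apply] at *
      simp
      nlinarith
    have hmem : z₁ * (1 - t * ζ) ∈ ball (0 : ℂ) ‖z₁‖ := by
      rw [mem_ball_zero_iff, norm_mul]
      exact mul_lt_of_lt_one_right (norm_pos_iff.2 hz₁) hn
    have := hcone _ hmem
    simp only [slope_def_module, Function.comp, Complex.ofReal_zero, zero_mul, sub_zero, mul_one,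
      hp1, norm_smul, Complex.smul_re, smul_eq_mul, norm_inv, Real.norm_of_nonneg ht0.le]
    rw [mul_assoc]
    exact mul_le_mul_of_nonneg_left this (inv_pos.2 ht0).le
  have key' : ∀ ζ : ℂ, 0 ≤ ζ.re → ‖-ζ * g‖ * c ≤ (-ζ * g).re := by
    intro ζ hζ
    have hc1 : Continuous fun t : ℝ => ‖-(ζ + t) * g‖ * c := by fun_prop
    have hc2 : Continuous fun t : ℝ => (-(ζ + t) * g).re := by fun_prop
    have h := le_of_tendsto_of_tendsto (b := 𝓝[>] (0 : ℝ)) (hc1.continuousWithinAt.tendsto)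
      (hc2.continuousWithinAt.tendsto) (by
        filter_upwards [self_mem_nhdsWithin] with t ht
        apply key
        have : (0 : ℝ) < t := ht
        simp; linarith)
    simpa using h
  set θ := Complex.arg g with hθ
  have hθα := harg.2
  have hθπ := Complex.abs_arg_le_pi g
  -- η is the point of [-π/2, π/2] nearest to θ; when |θ| > π/2 the distance is below π(α - 1)/2,
  -- and α + β < 3 makes this small enough. The inward direction -exp(-iη) then sends p out of the
  -- cone.
  obtain ⟨η, hη, hθη⟩ : ∃ η : ℝ, |η| ≤ Real.pi / 2 ∧ |θ - η| < Real.pi - Real.pi / 2 * β := by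
    have hb : 0 < Real.pi - Real.pi / 2 * β := by nlinarith
    have hs : Real.pi / 2 * α - Real.pi / 2 < Real.pi - Real.pi / 2 * β := by nlinarith
    rcases le_total |θ| (Real.pi / 2) with h | h
    · exact ⟨θ, h, by simpa using hb⟩
    · rcases le_total 0 θ with h0 | h0
      · rw [abs_of_nonneg h0] at h hθα
        refine ⟨Real.pi / 2, by rw [abs_of_pos (by positivity)], ?_⟩
        rw [abs_of_nonneg (by linarith)]; linarith
      · rw [abs_of_nonpos h0] at h hθα
        refine ⟨-(Real.pi / 2), by rw [abs_neg, abs_of_pos (by positivity)], ?_⟩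
        rw [abs_of_nonpos (by linarith)]; linarith
  have hζ := key' (Complex.exp (((-η : ℝ) : ℂ) * I)) (by
    rw [Complex.exp_ofReal_mul_I_re, Real.cos_neg]
    have := abs_le.1 hη
    exact Real.cos_nonneg_of_neg_pi_div_two_le_of_le this.1 this.2)
  have hgn : 0 < ‖g‖ := norm_pos_iff.2 harg.1
  rw [norm_mul, norm_neg, Complex.norm_exp_ofReal_mul_I, one_mul] at hζ
  have hprod : -Complex.exp (((-η : ℝ) : ℂ) * I) * g
      = -((‖g‖ : ℝ) * Complex.exp (((θ - η : ℝ) : ℂ) * I)) := by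
    conv_lhs => rw [← Complex.norm_mul_exp_arg_mul_I g]
    rw [neg_mul, mul_left_comm, ← Complex.exp_add, ← hθ]
    congr 3
    push_cast; ring
  rw [hprod, Complex.neg_re, Complex.re_ofReal_mul, Complex.exp_ofReal_mul_I_re] at hζ
  have hlt : Real.cos (Real.pi - Real.pi / 2 * β) < Real.cos (θ - η) := by
    rw [← Real.cos_abs (θ - η)]
    exact Real.cos_lt_cos_of_nonneg_of_le_pi (abs_nonneg _)
      (by have : 0 < Real.pi / 2 * β := by positivity
          linarith) hθη
  rw [Real.cos_pi_sub, ← hc] at hlt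
  nlinarith

theorem deriv_eq_mul_deriv_of_exp_eq {p L : ℂ → ℂ} {U : Set ℂ} (hU : IsOpen U)
    (hL : DifferentiableOn ℂ L U) (hexp : ∀ z ∈ U, Complex.exp (L z) = p z) {z : ℂ} (hz : z ∈ U) :
    deriv p z = p z * deriv L z := by
  have hev : p =ᶠ[𝓝 z] fun z => Complex.exp (L z) := by
    filter_upwards [hU.mem_nhds hz] with y hy using (hexp y hy).symm
  rw [hev.deriv_eq, (hL.differentiableAt (hU.mem_nhds hz)).hasDerivAt.cexp.deriv, hexp z hz]

/-- If `p + z p'` has argument less than `πα/2` in modulus, with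
`α = β + (2/π) arctan (nβ)`, then `p` has a logarithm with imaginary part less than `πβ/2`. -/
theorem exists_log_abs_im_lt {p : ℂ → ℂ} {α β : ℝ} {n : ℕ} (hn : 1 ≤ n) (hβ : 0 < β)
    (hαβ : α = β + 2 / Real.pi * Real.arctan (n * β)) (hα2 : α ≤ 2) (hsum : α + β < 3)
    (hp : DifferentiableOn ℂ p (ball 0 1)) (hp0 : p 0 = 1)
    (hord : n ≤ analyticOrderAt (fun z => p z - 1) 0)
    (harg : ∀ z ∈ ball (0 : ℂ) 1, AbsArgLT (p z + z * deriv p z) (Real.pi / 2 * α)) :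
    ∃ L : ℂ → ℂ, DifferentiableOn ℂ L (ball 0 1) ∧ n ≤ analyticOrderAt L 0 ∧
      ∀ z ∈ ball (0 : ℂ) 1, Complex.exp (L z) = p z ∧ |(L z).im| < Real.pi / 2 * β := by
  -- The radius is left free for two uses: up to a hypothetical first zero, in order to exclude it,
  -- and then on the whole disk.
  have hlog : ∀ R, 0 < R → R ≤ 1 → (∀ z ∈ ball (0 : ℂ) R, p z ≠ 0) →
      ∃ L : ℂ → ℂ, DifferentiableOn ℂ L (ball 0 R) ∧ n ≤ analyticOrderAt L 0 ∧
      ∀ z ∈ ball (0 : ℂ) R, Complex.exp (L z) = p z ∧ |(L z).im| < Real.pi / 2 * β := by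
    intro R hR hR1 hne
    have hsub : ball (0 : ℂ) R ⊆ ball 0 1 := ball_subset_ball hR1
    obtain ⟨L, hL, hL0, hexp⟩ := exists_log_on_ball hR (hp.mono hsub) hp0 hne
    have hLord : n ≤ analyticOrderAt L 0 := by
      rw [analyticOrderAt_log (hL.analyticAt (ball_mem_nhds _ hR)) hL0]
      · exact hord
      · filter_upwards [ball_mem_nhds _ hR] with z hz using hexp z hz
    have := abs_im_lt_of_absArgLT hn hβ hαβ hα2 hsum hL hLord (by
      intro z hz
      have h := harg z (hsub hz)
      rw [deriv_eq_mul_deriv_of_exp_eq isOpen_ball hL hexp hz] at h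
      rw [hexp z hz]
      convert h using 1
      ring)
    exact ⟨L, hL, hLord, fun z hz => ⟨hexp z hz, this z hz⟩⟩
  apply hlog 1 one_pos le_rfl
  by_contra! hcon
  obtain ⟨zs, hzs, hzp⟩ := hcon
  have hsub1 : closedBall (0 : ℂ) ‖zs‖ ⊆ ball 0 1 := by
    apply closedBall_subset_ball; simpa using hzs
  have hK : IsCompact (closedBall (0 : ℂ) ‖zs‖ ∩ p ⁻¹' {0}) := by
    apply (isCompact_closedBall _ _).of_isClosed_subset _ Set.inter_subset_left
    exact (hp.continuousOn.mono hsub1).preimage_isClosed_of_isClosed isClosed_closedBall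
      isClosed_singleton
  obtain ⟨z₁, ⟨hz₁b, hz₁c⟩, hmin⟩ :=
    hK.exists_isMinOn ⟨zs, by simp, hzp⟩ continuous_norm.continuousOn
  have hz₁R := hsub1 hz₁b
  have hz₁ : z₁ ≠ 0 := by
    rintro rfl
    simp [hp0] at hz₁c
  have hz₁n : ‖z₁‖ < 1 := by simpa using hz₁R
  obtain ⟨L, -, -, hL⟩ := hlog ‖z₁‖ (norm_pos_iff.2 hz₁) hz₁n.le (by
    intro z hz hpz
    have h1 : ‖z‖ < ‖z₁‖ := by simpa using hz
    have h2 : ‖z₁‖ ≤ ‖zs‖ := by simpa using hz₁b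
    have := hmin (a := z) ⟨by simpa using (h1.le.trans h2), hpz⟩
    simp at this
    linarith)
  have hβ2 : β < 2 := by
    have : 0 < 2 / Real.pi * Real.arctan (n * β) := by
      have : 0 < Real.arctan (n * β) := Real.arctan_pos.2 (by positivity)
      positivity
    linarith
  exact ne_zero_of_log_on_ball hz₁ hβ hβ2 hsum (hp.differentiableAt (isOpen_ball.mem_nhds hz₁R))
    (fun z hz => (hL z hz).1) (fun z hz => (hL z hz).2) (harg z₁ hz₁R) hz₁c

/-! ### The constant φ(μ) and the expression P² + zP' -/

/-- Weighted AM-GM with weights (1 ± μ)/2. The terms `T * P` and `P` are scaled so that their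
weighted sum is the right side and x cancels from the geometric mean; they agree when e^{2x} = (1 +
μ)/(1 - μ). -/
theorem two_div_mul_rpow_le {μ : ℝ} (hμ0 : 0 < μ) (hμ1 : μ < 1) (x : ℝ) :
    2 / (1 - μ) * ((1 - μ) / (1 + μ)) ^ ((1 + μ) / 2) ≤
      (Real.exp x + (Real.exp x)⁻¹) / Real.exp (μ * x) := by
  have h1 : 0 < 1 - μ := by linarith
  have h2 : 0 < 1 + μ := by linarith
  set P := 2 / (1 - μ) * Real.exp (-((1 + μ) * x)) with hP
  set T := (1 - μ) / (1 + μ) * Real.exp (2 * x) with hT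
  have hP0 : 0 < P := by positivity
  have hT0 : 0 < T := by positivity
  have h := Real.geom_mean_le_arith_mean2_weighted (w₁ := (1 + μ) / 2) (w₂ := (1 - μ) / 2)
    (p₁ := T * P) (p₂ := P) (by positivity) (by positivity) (by positivity) hP0.le (by ring)
  have hlhs : (T * P) ^ ((1 + μ) / 2) * P ^ ((1 - μ) / 2)
      = 2 / (1 - μ) * ((1 - μ) / (1 + μ)) ^ ((1 + μ) / 2) := by
    rw [Real.mul_rpow hT0.le hP0.le, mul_assoc, ← Real.rpow_add hP0,
      show (1 + μ) / 2 + (1 - μ) / 2 = 1 by ring, Real.rpow_one, hT,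
      Real.mul_rpow (by positivity) (Real.exp_pos _).le, ← Real.exp_mul, hP,
      show 2 * x * ((1 + μ) / 2) = (1 + μ) * x by ring, Real.exp_neg]
    field_simp
  have hrhs : (1 + μ) / 2 * (T * P) + (1 - μ) / 2 * P
      = (Real.exp x + (Real.exp x)⁻¹) / Real.exp (μ * x) := by
    have e1 : Real.exp (2 * x) = Real.exp x * Real.exp x := by rw [← Real.exp_add]; ring_nf
    have e2 : Real.exp (-((1 + μ) * x)) = (Real.exp x)⁻¹ * (Real.exp (μ * x))⁻¹ := by
      rw [← Real.exp_neg, ← Real.exp_neg, ← Real.exp_add]; ring_nf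
    rw [hT, hP, e1, e2]
    field_simp
  rw [hlhs, hrhs] at h
  exact h

/-- The right side is the lifted argument of P² + zP' at an exit point with P of modulus e^{μx};
φ(μ) is the bound for the worst x. -/
theorem phiBound_le_of_le {n : ℕ} {μ x k : ℝ} (hμ0 : 0 < μ) (hμ1 : μ ≤ 1)
    (hk : n / 2 * (Real.exp x + (Real.exp x)⁻¹) ≤ k) :
    phiBound n μ ≤ Real.pi / 2 * (μ + 1) - Real.arctan (Real.cos (μ * Real.pi / 2) /
      (Real.sin (μ * Real.pi / 2) + k * μ / Real.exp (μ * x))) := by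
  have hpi := Real.pi_pos
  have hsin : 0 < Real.sin (μ * Real.pi / 2) :=
    Real.sin_pos_of_pos_of_lt_pi (by positivity) (by nlinarith)
  have hcos : 0 ≤ Real.cos (μ * Real.pi / 2) :=
    Real.cos_nonneg_of_neg_pi_div_two_le_of_le (by nlinarith) (by nlinarith)
  unfold phiBound
  gcongr Real.pi / 2 * (μ + 1) - ?_
  apply Real.arctan_strictMono.monotone
  rcases hμ1.eq_or_lt with rfl | h
  -- At μ = 1 the cosine vanishes and so do both arctangents, whatever value the division by 1 - μ =
  -- 0 takes.
  · simp
  · have h1 : 0 < 1 - μ := by linarith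
    have h2 : 0 < 1 + μ := by linarith
    have hle : n * μ / (1 - μ) * ((1 - μ) / (1 + μ)) ^ ((1 + μ) / 2)
        ≤ k * μ / Real.exp (μ * x) := by
      calc n * μ / (1 - μ) * ((1 - μ) / (1 + μ)) ^ ((1 + μ) / 2)
          = n / 2 * μ * (2 / (1 - μ) * ((1 - μ) / (1 + μ)) ^ ((1 + μ) / 2)) := by
            field_simp
        _ ≤ n / 2 * μ * ((Real.exp x + (Real.exp x)⁻¹) / Real.exp (μ * x)) := by
            gcongr
            exact two_div_mul_rpow_le hμ0 h x
        _ = (n / 2 * (Real.exp x + (Real.exp x)⁻¹)) * μ / Real.exp (μ * x) := by ring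
        _ ≤ k * μ / Real.exp (μ * x) := by gcongr
    have : 0 ≤ n * μ / (1 - μ) * ((1 - μ) / (1 + μ)) ^ ((1 + μ) / 2) := by positivity
    gcongr

theorem phiBound_le_pi {n : ℕ} {μ : ℝ} (hμ0 : 0 < μ) (hμ1 : μ ≤ 1) :
    phiBound n μ ≤ Real.pi := by
  have hpi := Real.pi_pos
  refine (phiBound_le_of_le (x := 0) hμ0 hμ1 le_rfl).trans ?_
  have hsin : 0 < Real.sin (μ * Real.pi / 2) :=
    Real.sin_pos_of_pos_of_lt_pi (by positivity) (by nlinarith)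
  have hcos : 0 ≤ Real.cos (μ * Real.pi / 2) :=
    Real.cos_nonneg_of_neg_pi_div_two_le_of_le (by nlinarith) (by nlinarith)
  have : 0 ≤ Real.arctan (Real.cos (μ * Real.pi / 2) /
      (Real.sin (μ * Real.pi / 2) +
        n / 2 * (Real.exp 0 + (Real.exp 0)⁻¹) * μ / Real.exp (μ * 0))) :=
    Real.arctan_nonneg.2 (by positivity)
  nlinarith

/-- With `P = exp M`: if `|arg (P² + z P')| < φ(μ)` in the unit disk, then
`|arg P| < πμ/2`. -/
theorem abs_im_lt_of_absArgLT_phiBound {M : ℂ → ℂ} {μ : ℝ} {n : ℕ} (hn : 1 ≤ n) (hμ0 : 0 < μ)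
    (hμ1 : μ ≤ 1) (hφ : 0 ≤ phiBound n μ)
    (hM : DifferentiableOn ℂ M (ball 0 1)) (hord : n ≤ analyticOrderAt M 0)
    (harg : ∀ z ∈ ball (0 : ℂ) 1,
      AbsArgLT (Complex.exp (M z) * (Complex.exp (M z) + z * deriv M z)) (phiBound n μ)) :
    ∀ z ∈ ball (0 : ℂ) 1, |(M z).im| < Real.pi / 2 * μ := by
  by_contra! hcon
  obtain ⟨z₀, hz₀, s, k, hs, hk, him, hder⟩ := exists_exit_point hn hμ0 hM hord hcon
  have hpi := Real.pi_pos
  have hn' : (1 : ℝ) ≤ n := by exact_mod_cast hn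
  have hsin : 0 < Real.sin (μ * Real.pi / 2) :=
    Real.sin_pos_of_pos_of_lt_pi (by positivity) (by nlinarith)
  have hcos : 0 ≤ Real.cos (μ * Real.pi / 2) :=
    Real.cos_nonneg_of_neg_pi_div_two_le_of_le (by nlinarith) (by nlinarith)
  set x := (M z₀).re / μ with hx
  have hxμ : (M z₀).re = μ * x := by rw [hx]; field_simp
  have hk0 : 0 < k := lt_of_lt_of_le (by positivity) hk
  have hφle := phiBound_le_of_le hμ0 hμ1 hk
  set r := Real.exp (μ * x) with hr
  have hr0 : 0 < r := Real.exp_pos _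
  -- X + siY is P + zM' at the exit point: exp M has modulus r and argument sπμ/2, and zM' = sikμ.
  set X := r * Real.cos (μ * Real.pi / 2) with hX
  set Y := r * Real.sin (μ * Real.pi / 2) + k * μ with hY
  have hY0 : 0 < Y := by positivity
  have hXY : X / Y = Real.cos (μ * Real.pi / 2) /
      (Real.sin (μ * Real.pi / 2) + k * μ / r) := by
    rw [hX, hY]; field_simp
  rw [← hXY] at hφle
  obtain ⟨ρ, hρ⟩ := exists_exp_eq_of_im_pos X hY0 hs
  have hexpM : Complex.exp (M z₀) =
      r * Real.cos (μ * Real.pi / 2) + s * (r * Real.sin (μ * Real.pi / 2)) * I := by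
    rw [← Complex.re_add_im (M z₀), him, hxμ, Complex.exp_add, Complex.exp_mul_I,
      ← Complex.ofReal_exp, ← hr, ← Complex.ofReal_cos, ← Complex.ofReal_sin]
    have : Real.pi / 2 * μ = μ * Real.pi / 2 := by ring
    rw [this]
    rcases hs with rfl | rfl
    · simp; ring
    · simp; ring
  have heq : Complex.exp (M z₀) * (Complex.exp (M z₀) + z₀ * deriv M z₀) = Complex.exp
      (M z₀ + (ρ + (s * (Real.pi / 2 - Real.arctan (X / Y)) : ℝ) * I)) := by
    rw [Complex.exp_add, hρ, hder]
    congr 1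
    rw [hexpM, hX, hY]; push_cast; ring
  have h := harg z₀ hz₀
  rw [heq] at h
  have hcosarg := h.cos_lt_cos_im (phiBound_le_pi hμ0 hμ1)
  have hval : (M z₀ + (ρ + (s * (Real.pi / 2 - Real.arctan (X / Y)) : ℝ) * I)).im
      = s * (Real.pi / 2 * (μ + 1) - Real.arctan (X / Y)) := by
    simp only [Complex.add_im, him, Complex.ofReal_im, Complex.mul_I_im,
      Complex.ofReal_re, zero_add]
    ring
  have habs : |(M z₀ + (ρ + (s * (Real.pi / 2 - Real.arctan (X / Y)) : ℝ) * I)).im|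
      = Real.pi / 2 * (μ + 1) - Real.arctan (X / Y) := by
    rw [hval, abs_mul, abs_of_nonneg (hφ.trans hφle)]
    rcases hs with rfl | rfl <;> simp
  have hat : 0 ≤ Real.arctan (X / Y) := Real.arctan_nonneg.2 (by positivity)
  have := cos_le_cos_of_le_abs hφ (hφle.trans_eq habs.symm) (by
    rw [habs]
    have := phiBound_le_pi (n := n) hμ0 hμ1
    nlinarith)
  linarith

/-! ### Division by z, the class 𝒜ₙ and the Alexander integral -/

/-- Properties of the quotient `q(z) = F(z)/z`, with `q(0) = F'(0)`. -/
theorem dslope_zero_properties {F : ℂ → ℂ} (hF : DifferentiableOn ℂ F (ball 0 1))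
    (hF0 : F 0 = 0) :
    DifferentiableOn ℂ (dslope F 0) (ball 0 1) ∧ dslope F 0 0 = deriv F 0 ∧
      (∀ z, z * dslope F 0 z = F z) ∧
      ∀ z ∈ ball (0 : ℂ) 1, dslope F 0 z + z * deriv (dslope F 0) z = deriv F z := by
  have hd : DifferentiableOn ℂ (dslope F 0) (ball 0 1) :=
    (Complex.differentiableOn_dslope (ball_mem_nhds _ one_pos)).2 hF
  have hmul : ∀ z, z * dslope F 0 z = F z := by
    intro z
    have := sub_smul_dslope F 0 z
    simpa [hF0] using this
  refine ⟨hd, dslope_same _ _, hmul, ?_⟩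
  intro z hz
  have h1 : F = fun z => z * dslope F 0 z := funext fun z => (hmul z).symm
  have h2 := ((hasDerivAt_id z).fun_mul
    (hd.differentiableAt (isOpen_ball.mem_nhds hz)).hasDerivAt).deriv
  conv_rhs => rw [h1]
  simp only [id, one_mul] at h2
  exact h2.symm

theorem le_analyticOrderAt_dslope_sub_one {F : ℂ → ℂ} {n : ℕ}
    (hF : DifferentiableOn ℂ F (ball 0 1)) (hF0 : F 0 = 0)
    (hord : (n + 1 : ℕ) ≤ analyticOrderAt (fun z => F z - z) 0) :
    n ≤ analyticOrderAt (fun z => dslope F 0 z - 1) 0 := by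
  obtain ⟨hd, -, hmul, -⟩ := dslope_zero_properties hF hF0
  have han : AnalyticAt ℂ (dslope F 0) 0 := hd.analyticAt (ball_mem_nhds _ one_pos)
  have heq : (fun z => F z - z) = id * fun z => dslope F 0 z - 1 := by
    funext z
    simp only [Pi.mul_apply, id, ← hmul z]; ring
  rw [heq, analyticOrderAt_mul (by fun_prop) (by fun_prop), analyticOrderAt_id, add_comm] at hord
  push_cast at hord
  exact (ENat.add_le_add_iff_left (k := 1) (by simp)).1 (by rwa [add_comm (1 : ℕ∞)] at hord ⊢)

/-- The order of f - z encodes all the coefficient conditions, f'(0) = 1 included because n ≥ 1, and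
it behaves well under quotients by z and primitives. -/
theorem mem_classA_iff {f : ℂ → ℂ} {n : ℕ} (hn : 1 ≤ n) :
    f ∈ classA n ↔ DifferentiableOn ℂ f (ball 0 1) ∧ f 0 = 0 ∧
      (n + 1 : ℕ) ≤ analyticOrderAt (fun z => f z - z) 0 := by
  have hball : ball (0 : ℂ) 1 ∈ 𝓝 0 := ball_mem_nhds _ one_pos
  have hd : ∀ {f : ℂ → ℂ}, AnalyticAt ℂ f 0 → ∀ k : ℕ,
      iteratedDeriv k (fun z => f z - z) 0 = iteratedDeriv k f 0 - iteratedDeriv k (fun z => z) 0 :=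
    fun hf k => iteratedDeriv_fun_sub hf.contDiffAt (by fun_prop)
  have hid : ∀ k : ℕ, 2 ≤ k → iteratedDeriv k (fun z : ℂ => z) 0 = 0 := by
    intro k hk
    obtain ⟨m, rfl⟩ := Nat.exists_eq_add_of_le' hk
    simp [iteratedDeriv_succ']
  constructor
  · rintro ⟨hf, hf0, hf1, hfk⟩
    refine ⟨hf.differentiableOn, hf0, ?_⟩
    have han := hf 0 (mem_ball_self one_pos)
    rw [natCast_le_analyticOrderAt_iff_iteratedDeriv_eq_zero (by fun_prop)]
    intro k hk
    rw [hd han]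
    match k with
    | 0 => simp [hf0]
    | 1 => simp [hf1]
    | k + 2 => rw [hid _ (by omega), hfk _ (by omega) (by omega), sub_zero]
  · rintro ⟨hf, hf0, hord⟩
    have han := hf.analyticAt hball
    rw [natCast_le_analyticOrderAt_iff_iteratedDeriv_eq_zero (by fun_prop)] at hord
    refine ⟨hf.analyticOnNhd isOpen_ball, hf0, ?_, ?_⟩
    · have := hord 1 (by omega)
      rw [hd han] at this
      simp at this
      linear_combination this
    · intro k hk hkn
      have := hord k (by omega)
      rwa [hd han, hid k hk, sub_zero] at this

/-- The Alexander integral is the primitive of `f(z)/z` vanishing at the origin. -/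
theorem alexander_eq_of_hasDerivAt {f F p : ℂ → ℂ} (hF0 : F 0 = 0)
    (hp : ContinuousOn p (ball 0 1)) (hfp : ∀ z, z * p z = f z)
    (hF : ∀ z ∈ ball (0 : ℂ) 1, HasDerivAt F (p z) z) {z : ℂ} (hz : z ∈ ball (0 : ℂ) 1) :
    alexander f z = F z := by
  have hmem : ∀ s ∈ Set.uIcc (0 : ℝ) 1, (s : ℂ) * z ∈ ball (0 : ℂ) 1 := by
    intro s hs
    rw [Set.uIcc_of_le zero_le_one] at hs
    rw [mem_ball_zero_iff] at hz ⊢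
    rw [norm_mul, Complex.norm_real, Real.norm_of_nonneg hs.1]
    nlinarith [norm_nonneg z, hs.1, hs.2]
  have hcongr : alexander f z = ∫ s in (0 : ℝ)..1, p ((s : ℂ) * z) * z := by
    unfold alexander
    -- At s = 0 the integrand is 0/0 = 0 and may differ from p(0)z; the half-open interval leaves
    -- this point out.
    apply intervalIntegral.integral_congr_ae
    refine Filter.Eventually.of_forall fun s hs => ?_
    rw [Set.uIoc_of_le zero_le_one] at hs
    by_cases h0 : z = 0
    · simp [h0]
    · have hs0 : (s : ℂ) ≠ 0 := by exact_mod_cast hs.1.ne'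
      rw [← hfp]
      field_simp
  rw [hcongr, intervalIntegral.integral_eq_sub_of_hasDerivAt
    (f := fun s : ℝ => F ((s : ℂ) * z)) (f' := fun s : ℝ => p ((s : ℂ) * z) * z)]
  · simp [hF0]
  · intro s hs
    have h1 : HasDerivAt (fun t : ℂ => t * z) z (s : ℂ) := by
      simpa using (hasDerivAt_id (s : ℂ)).mul_const z
    exact ((hF _ (hmem s hs)).comp (s : ℂ) h1).comp_ofReal
  · apply ContinuousOn.intervalIntegrable
    refine ContinuousOn.mul ?_ continuousOn_const
    exact hp.comp (by fun_prop) hmem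

/-! ### The main theorem -/

theorem theorem2 (n : ℕ) (hn : 1 ≤ n) (α β γ μ : ℝ)
    (hα : 0 < α) (hγ : 0 < γ) (hμ0 : 0 < μ) (hμ1 : μ ≤ 1)
    (hαβ : α = β + 2 / Real.pi * Real.arctan (n * β))
    (hβγ : β = γ + 2 / Real.pi * Real.arctan (n * γ))
    (hφ : Real.pi / 2 * (α + γ) ≤ phiBound n μ)
    (f : ℂ → ℂ) (hf : f ∈ classA n)
    (harg : ∀ z ∈ Metric.ball (0 : ℂ) 1, AbsArgLT (deriv f z) (Real.pi / 2 * α)) :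
    alexander f ∈ classSTS n μ := by
  have hpi := Real.pi_pos
  have hφπ := phiBound_le_pi (n := n) hμ0 hμ1
  have hatan : ∀ x : ℝ, 0 < x →
      0 < 2 / Real.pi * Real.arctan (n * x) ∧ 2 / Real.pi * Real.arctan (n * x) < 1 := by
    intro x hx
    have h1 : 0 < Real.arctan (n * x) := Real.arctan_pos.2 (by positivity)
    refine ⟨by positivity, ?_⟩
    have h2 := Real.arctan_lt_pi_div_two (n * x)
    rw [div_mul_eq_mul_div, div_lt_one hpi]
    linarith
  have hγb := hatan γ hγ
  have hβ : 0 < β := by linarith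
  have hβb := hatan β hβ
  -- This comes from φ(μ) ≤ π. With β < γ + 1 it yields α + β < 3, and with β < α it yields β + γ <
  -- 3.
  have hαγ : α + γ ≤ 2 := by
    have : Real.pi / 2 * (α + γ) ≤ Real.pi / 2 * 2 := by linarith
    exact le_of_mul_le_mul_left this (by positivity)
  obtain ⟨hfd, hf0, hford⟩ := (mem_classA_iff hn).1 hf
  obtain ⟨hpd, -, hpmul, hpder⟩ := dslope_zero_properties hfd hf0
  have hpord := le_analyticOrderAt_dslope_sub_one hfd hf0 hford
  set p := dslope f 0 with hp
  have hp0 : p 0 = 1 := by rw [hp, dslope_same]; exact hf.2.2.1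
  obtain ⟨Lp, hLpd, hLpord, hLp⟩ := exists_log_abs_im_lt hn hβ hαβ (by linarith) (by linarith)
    hpd hp0 hpord (fun z hz => by rw [hpder z hz]; exact harg z hz)
  obtain ⟨F, hF0, hF⟩ := hpd.isExactOn_ball.with_val_at 0 0
  have hball : ball (0 : ℂ) 1 ∈ 𝓝 0 := ball_mem_nhds _ one_pos
  have hFd : DifferentiableOn ℂ F (ball 0 1) :=
    fun z hz => (hF z hz).differentiableAt.differentiableWithinAt
  have hFan := hFd.analyticAt hball
  have hFord : (n + 1 : ℕ) ≤ analyticOrderAt (fun z => F z - z) 0 := by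
    push_cast
    rw [← analyticOrderAt_deriv_ge_iff (by fun_prop) (by simp [hF0])]
    have hev : deriv (fun z => F z - z) =ᶠ[𝓝 0] fun z => p z - 1 := by
      filter_upwards [hball] with z hz
      exact ((hF z hz).sub (hasDerivAt_id z)).deriv
    rwa [analyticOrderAt_congr hev]
  obtain ⟨hqd, hq0, hqmul, hqder⟩ := dslope_zero_properties hFd hF0
  have hqord := le_analyticOrderAt_dslope_sub_one hFd hF0 hFord
  set q := dslope F 0 with hq
  rw [(hF 0 (mem_ball_self one_pos)).deriv, hp0] at hq0
  obtain ⟨Lq, hLqd, hLqord, hLq⟩ := exists_log_abs_im_lt hn hγ hβγ (by linarith) (by linarith)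
    hqd hq0 hqord (fun z hz => by
      rw [hqder z hz, (hF z hz).deriv, ← (hLp z hz).1]
      exact absArgLT_exp (by nlinarith) (hLp z hz).2)
  have hMd : DifferentiableOn ℂ (Lp - Lq) (ball 0 1) := hLpd.sub hLqd
  have hMord : n ≤ analyticOrderAt (Lp - Lq) 0 :=
    (le_min hLpord hLqord).trans le_analyticOrderAt_sub
  have hexpM : ∀ z ∈ ball (0 : ℂ) 1, Complex.exp ((Lp - Lq) z) = p z / q z := by
    intro z hz
    rw [Pi.sub_apply, Complex.exp_sub, (hLp z hz).1, (hLq z hz).1]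
  have hqne : ∀ z ∈ ball (0 : ℂ) 1, q z ≠ 0 := by
    intro z hz
    rw [← (hLq z hz).1]; exact Complex.exp_ne_zero _
  have hMim := abs_im_lt_of_absArgLT_phiBound hn hμ0 hμ1
    ((by positivity : 0 ≤ Real.pi / 2 * (α + γ)).trans hφ) hMd hMord (by
    intro z hz
    have hg := harg z hz
    have hz' := isOpen_ball.mem_nhds hz
    have hMder : deriv (Lp - Lq) z = deriv Lp z - deriv Lq z :=
      deriv_sub (hLpd.differentiableAt hz') (hLqd.differentiableAt hz')
    have h1 := deriv_eq_mul_deriv_of_exp_eq isOpen_ball hLpd (fun z hz => (hLp z hz).1) hz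
    have h2 := deriv_eq_mul_deriv_of_exp_eq isOpen_ball hLqd (fun z hz => (hLq z hz).1) hz
    have h3 := hpder z hz
    have h4 := hqder z hz
    rw [(hF z hz).deriv] at h4
    have hqz := hqne z hz
    -- Here zLq' = P - 1 and zLp' = f'/p - 1, so P + zM' = f'/p and the product with P is f'/q.
    have heq : Complex.exp ((Lp - Lq) z) * (Complex.exp ((Lp - Lq) z) + z * deriv (Lp - Lq) z)
        = Complex.exp (Complex.log (deriv f z) - Lq z) := by
      rw [Complex.exp_sub, Complex.exp_log hg.1, (hLq z hz).1, hexpM z hz, hMder, ← h3, h1]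
      rw [h2] at h4
      field_simp
      linear_combination -p z * h4
    rw [heq]
    apply absArgLT_exp hφπ
    have h5 := hg.2
    have h6 := (hLq z hz).2
    rw [Complex.sub_im, Complex.log_im]
    have := abs_sub (Complex.arg (deriv f z)) (Lq z).im
    linarith)
  have hAl : Set.EqOn (alexander f) F (ball 0 1) :=
    fun z hz => alexander_eq_of_hasDerivAt hF0 hpd.continuousOn hpmul hF hz
  have hAev : ∀ z ∈ ball (0 : ℂ) 1, alexander f =ᶠ[𝓝 z] F := fun z hz =>
    hAl.eventuallyEq_of_mem (isOpen_ball.mem_nhds hz)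
  refine ⟨(mem_classA_iff hn).2 ⟨hFd.congr hAl, ?_, ?_⟩, ?_⟩
  · rw [hAl (mem_ball_self one_pos), hF0]
  · rwa [analyticOrderAt_congr (f := fun z => alexander f z - z) (g := fun z => F z - z)
      ((hAev 0 (mem_ball_self one_pos)).sub EventuallyEq.rfl)]
  · intro z hz hz0
    rw [hAl hz, (hAev z hz).deriv_eq, (hF z hz).deriv, ← hqmul z]
    refine ⟨mul_ne_zero hz0 (hqne z hz), ?_⟩
    rw [mul_div_mul_left _ _ hz0, ← hexpM z hz]
    exact absArgLT_exp (by nlinarith) (hMim z hz)
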